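/- Let $\mathbb{D}$ be the open unit disk in $\mathbb{C}$ and let $dA = \frac{1}{\pi}\,dx\,dy$ be the normalized area measure on $\mathbb{D}$. For $\alpha > -1$ and $p > 0$, put $d\mu_\alpha(z) = (\alpha+1)(1-|z|^2)^\alpha\,dA(z)$; the weighted Bergman space $A^p_\alpha$ is the set of holomorphic functions $f$ on $\mathbb{D}$ such that $$\|f\|_{A^p_\alpha} := \left(\int_{\mathbb{D}} |f|^p\,d\mu_\alpha\right)^{1/p} < \infty.$$ The Bloch space $\mathcal{B}$ is the set of holomorphic functions $f$ on $\mathbb{D}$ such that $\rho_{\mathcal{B}}(f) := \sup_{z\in\mathbb{D}} |f'(z)|(1-|z|^2) < \infty$, with the norm $\|f\|_{\mathcal{B}} := |f(0)| + \rho_{\mathcal{B}}(f)$. Let $B(x,y) = \int_0^1 t^{x-1}(1-t)^{y-1}\,dt$ $(x,y>0)$ be the Euler Beta function. **Corollary.** For every real $\alpha \ge 0$ there exists a real number $$p_\alpha > 2\max\left\{1, \frac{1}{B\left(\frac12,\alpha+1\right)}\right\}$$ such that, for every $p \in (0, p_\alpha]$ and every $f \in \mathcal{B}$, one has $f \in A^p_\alpha$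 and $$\|f\|_{A^p_\alpha} \le \|f\|_{\mathcal{B}}.$$ -/

import Mathlib

open MeasureTheory

noncomputable section

/-- The Euler Beta function `B(x, y) = ∫₀¹ t^(x-1) (1-t)^(y-1) dt`, used for `x, y > 0`. -/
def eulerBeta (x y : ℝ) : ℝ :=
  ∫ t in (0 : ℝ)..1, t ^ (x - 1) * (1 - t) ^ (y - 1)

/-- The normalized area measure `dA = dx dy / π` on the open unit disk. -/
def diskArea : Measure ℂ :=
  ENNReal.ofReal (1 / Real.pi) • (volume.restrict (Metric.ball (0 : ℂ) 1))

/-- The weighted measure `dμ_α(z) = (α + 1) (1 - |z|²)^α dA(z)` on the open unit disk. -/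
def bergmanMeasure (α : ℝ) : Measure ℂ :=
  diskArea.withDensity fun z => ENNReal.ofReal ((α + 1) * (1 - ‖z‖ ^ 2) ^ α)

/-- Membership in the weighted Bergman space `A^p_α`: `f` is holomorphic in the unit disk and
`|f|^p` is integrable with respect to `μ_α`. Only the values of `f` in the disk matter. -/
def MemBergman (p α : ℝ) (f : ℂ → ℂ) : Prop :=
  DifferentiableOn ℂ f (Metric.ball 0 1) ∧ Integrable (fun z => ‖f z‖ ^ p) (bergmanMeasure α)

/-- The quantity `‖f‖_{A^p_α} = (∫ |f|^p dμ_α)^(1/p)`, meaningful for `f` in `A^p_α`. -/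
def bergmanNorm (p α : ℝ) (f : ℂ → ℂ) : ℝ :=
  (∫ z, ‖f z‖ ^ p ∂(bergmanMeasure α)) ^ (1 / p)

/-- The set of values `|f'(z)| (1 - |z|²)`, `|z| < 1`. -/
def blochValues (f : ℂ → ℂ) : Set ℝ :=
  (fun z : ℂ => ‖deriv f z‖ * (1 - ‖z‖ ^ 2)) '' Metric.ball 0 1

/-- Membership in the Bloch space: `f` is holomorphic in the unit disk and
`sup_{|z| < 1} |f'(z)| (1 - |z|²)` is finite. -/
def MemBloch (f : ℂ → ℂ) : Prop :=
  DifferentiableOn ℂ f (Metric.ball 0 1) ∧ BddAbove (blochValues f)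

/-- The Bloch seminorm `ρ(f) = sup_{|z| < 1} |f'(z)| (1 - |z|²)`, meaningful for Bloch `f`. -/
def blochSeminorm (f : ℂ → ℂ) : ℝ :=
  sSup (blochValues f)

/-- The Bloch norm `|f(0)| + ρ(f)`, meaningful for Bloch `f`. -/
def blochNorm (f : ℂ → ℂ) : ℝ :=
  ‖f 0‖ + blochSeminorm f

end

/-!
Write `g = f - f 0`. Minkowski's inequality and the monotonicity of `L^p` norms of the probability
measure `μ_α` reduce the claim to an exponent `P > 2 max {1, 1/B(1/2, α+1)}` with
`∫ |g|^P dμ_α ≤ 1` for every `g` with `g 0 = 0` and Bloch seminorm at most `1` (`IsBlochUnit`).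
It suffices to have `∫ |g|^q dμ_α ≤ κ` with `κ < 1` independent of `g` at
`q = 2 max {1, 1/B(1/2, α+1)}`: since `x^(q+ε) ≤ (1-ε) x^q + ε x^(q+1)` and the majorant
`artanh |z|` of `|g(z)|` has finite moments, a slightly larger exponent still works
(`exists_gt_forall_lintegral_rpow_le_one`).

If `B = B(1/2, α+1) < 1`, then `q = 2/B`, and the pointwise bound suffices. Let `J_p` be the `p`-th
moment of `artanh |z|`. Integration by parts turns `J_q` into `q ∫ (1-r²)^α artanh(r)^(q-1) dr`,
which by Chebyshev's inequality is strictly smaller than `q (B/2) J_{q-1} = J_{q-1}`, and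
`J_{q-1} ≤ ((q-1) J_q + 1)/q`, so that `J_q < 1` (`artanhMoment_lt_one`).

If `B ≥ 1`, then `q = 2`, and the moments of `|z|²` are largest for `α = 0`, so Parseval's identity
bounds `∫ |g|² dμ_α` by `∑ |a_n|²/(n+1)`, where `g = ∑ a_n z^n`. Let `x_n` be the squared moduli of
the Taylor coefficients of `g'`. Parseval for `g'` gives `∑ x_n t^n ≤ 1/(1-t)²`, and integrating
twice gives `∑ |a_n|²/(n+1) ≤ 1`. This is not enough, but the bound `|g'|⁴ ≤ 1/(1-t)⁴` on
the circle `|z|² = t` and Parseval for `(g')²` give `x_0² + 4 x_0 x_1 t ≤ 1/(1-t)⁴`, which keeps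
`(x_0, x_1)` away from the equality case `(1, 2)` and produces a constant strictly below `1` (`sum_div_le_of_sum_mul_pow_le`).
-/

open scoped ENNReal

/-! ### Parseval's identity for power series -/

/-- The exponentials are orthogonal on `[-π, π]`. -/
theorem integral_exp_mul_conj_exp (m n : ℕ) :
    ∫ θ in (-Real.pi)..Real.pi, Complex.exp (θ * Complex.I) ^ m *
      (starRingEnd ℂ) (Complex.exp (θ * Complex.I) ^ n) =
      if m = n then (2 * Real.pi : ℂ) else 0 := by
  have key : ∀ θ : ℝ, Complex.exp (θ * Complex.I) ^ m *
      (starRingEnd ℂ) (Complex.exp (θ * Complex.I) ^ n) =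
      Complex.exp ((((m : ℂ) - n) * Complex.I) * θ) := by
    intro θ
    rw [← Complex.exp_nat_mul, ← Complex.exp_nat_mul, ← Complex.exp_conj, ← Complex.exp_add]
    congr 1
    simp
    ring
  simp_rw [key]
  split_ifs with h
  · subst h
    simp
    ring
  · have hc : ((m : ℂ) - n) * Complex.I ≠ 0 := by
      refine mul_ne_zero (sub_ne_zero.mpr (by exact_mod_cast h)) Complex.I_ne_zero
    rw [integral_exp_mul_complex hc, div_eq_zero_iff]
    left
    rw [sub_eq_zero, Complex.exp_eq_exp_iff_exists_int]
    refine ⟨(m : ℤ) - n, ?_⟩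
    push_cast
    ring

/-- **Parseval's identity** for an absolutely convergent power series on the unit circle. -/
theorem hasSum_sq_norm_of_summable {a : ℕ → ℂ} (ha : Summable fun n => ‖a n‖) {F : ℝ → ℂ}
    (hF : ∀ θ : ℝ, HasSum (fun n => a n * Complex.exp (θ * Complex.I) ^ n) (F θ)) :
    HasSum (fun n => 2 * Real.pi * ‖a n‖ ^ 2) (∫ θ in (-Real.pi)..Real.pi, ‖F θ‖ ^ 2) := by
  have hnorm : ∀ θ : ℝ, ‖Complex.exp (θ * Complex.I)‖ = 1 := fun θ =>
    Complex.norm_exp_ofReal_mul_I θ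
  have hFc : Continuous F := by
    have : F = fun θ : ℝ => ∑' n, a n * Complex.exp (θ * Complex.I) ^ n := by
      ext θ; exact (hF θ).tsum_eq.symm
    rw [this]
    refine continuous_tsum (fun n => by fun_prop) ha fun n θ => ?_
    simp [hnorm]
  -- the Fourier coefficients of `F`
  have hcoef : ∀ n : ℕ, ∫ θ in (-Real.pi)..Real.pi,
      F θ * (starRingEnd ℂ) (Complex.exp (θ * Complex.I) ^ n) = a n * (2 * Real.pi) := by
    intro n
    have h1 : HasSum (fun m => ∫ θ in (-Real.pi)..Real.pi, a m * (Complex.exp (θ * Complex.I) ^ m *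
        (starRingEnd ℂ) (Complex.exp (θ * Complex.I) ^ n)))
        (∫ θ in (-Real.pi)..Real.pi,
          F θ * (starRingEnd ℂ) (Complex.exp (θ * Complex.I) ^ n)) := by
      refine intervalIntegral.hasSum_integral_of_dominated_convergence (fun m _ => ‖a m‖)
        (fun m => Continuous.aestronglyMeasurable (by fun_prop)) ?_ ?_ ?_ ?_
      · intro m
        refine Filter.Eventually.of_forall fun θ _ => ?_
        simp [hnorm]
      · exact Filter.Eventually.of_forall fun θ _ => ha
      · exact intervalIntegrable_const
      · refine Filter.Eventually.of_forall fun θ _ => ?_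
        simpa only [mul_assoc] using
          (hF θ).mul_right ((starRingEnd ℂ) (Complex.exp (θ * Complex.I) ^ n))
    rw [← h1.tsum_eq]
    simp_rw [intervalIntegral.integral_const_mul, integral_exp_mul_conj_exp]
    rw [tsum_eq_single n (fun m hm => by simp [hm])]
    simp
  -- expanding the conjugate factor of `‖F‖ ^ 2 = F * conj F` leaves only these coefficients
  have h2 : HasSum (fun n => ∫ θ in (-Real.pi)..Real.pi, (starRingEnd ℂ) (a n) *
      (F θ * (starRingEnd ℂ) (Complex.exp (θ * Complex.I) ^ n)))
      (∫ θ in (-Real.pi)..Real.pi, F θ * (starRingEnd ℂ) (F θ)) := by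
    obtain ⟨C, hC⟩ : ∃ C, ∀ θ, ‖F θ‖ ≤ C := by
      refine ⟨∑' n, ‖a n‖, fun θ => ?_⟩
      rw [← (hF θ).tsum_eq]
      refine tsum_of_norm_bounded ha.hasSum fun n => ?_
      simp [hnorm]
    refine intervalIntegral.hasSum_integral_of_dominated_convergence (fun m _ => ‖a m‖ * C)
      (fun m => Continuous.aestronglyMeasurable (by fun_prop)) ?_ ?_ ?_ ?_
    · intro m
      refine Filter.Eventually.of_forall fun θ _ => ?_
      simp only [norm_mul, RCLike.norm_conj, norm_pow, hnorm, one_pow, mul_one]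
      exact mul_le_mul_of_nonneg_left (hC θ) (norm_nonneg _)
    · exact Filter.Eventually.of_forall fun θ _ => ha.mul_right C
    · exact intervalIntegrable_const
    · refine Filter.Eventually.of_forall fun θ _ => ?_
      have := ((hF θ).map (starRingEnd ℂ) Complex.continuous_conj).mul_left (F θ)
      refine this.congr_fun fun n => ?_
      simp only [Function.comp, map_mul]
      ring
  simp_rw [intervalIntegral.integral_const_mul, hcoef, Complex.mul_conj, Complex.normSq_eq_norm_sq]
    at h2
  rw [intervalIntegral.integral_ofReal] at h2
  refine (Complex.hasSum_ofReal.mp ?_)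
  convert h2 using 2 with n
  rw [← mul_assoc, mul_comm ((starRingEnd ℂ) (a n)), Complex.mul_conj, Complex.normSq_eq_norm_sq]
  push_cast
  ring

/-! ### Sequences dominated by the coefficients of `1 / (1 - t) ^ 2` -/

/-- Quantitative gap: the hypothesis on `x 0 ^ 2 + 4 * x 0 * x 1 * t` forbids
`(x 0, x 1)` from being close to the leading coefficients `(1, 2)` of `1 / (1 - t) ^ 2`. -/
theorem sum_mul_pow_le_sub {x : ℕ → ℝ} (hx : ∀ n, 0 ≤ x n)
    (hS : ∀ (N : ℕ) (t : ℝ), 0 ≤ t → t < 1 →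
      ∑ n ∈ Finset.range N, x n * t ^ n ≤ 1 / (1 - t) ^ 2)
    (hsq : ∀ t : ℝ, 0 ≤ t → t < 1 → x 0 ^ 2 + 4 * x 0 * x 1 * t ≤ 1 / (1 - t) ^ 4)
    (N : ℕ) {t : ℝ} (ht1 : 1 / 4000 ≤ t) (ht2 : t ≤ 1 / 2000) :
    ∑ n ∈ Finset.range N, x n * t ^ n ≤ 1 / (1 - t) ^ 2 - 1 / 10000 := by
  have ht0 : 0 ≤ t := by linarith
  have hG : 1 + 2 * t ≤ 1 / (1 - t) ^ 2 := by
    rw [le_div_iff₀ (by nlinarith)]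
    nlinarith [mul_nonneg ht0 (mul_nonneg ht0 ht0)]
  have hx0 : x 0 ≤ 1 := by simpa using hS 1 0 le_rfl one_pos
  have hx1 : x 1 ≤ 8 := by
    have := hS 2 (1 / 2) (by norm_num) (by norm_num)
    simp only [Finset.sum_range_succ, Finset.sum_range_zero] at this
    norm_num at this
    linarith [hx 0]
  have hsum : ∑ n ∈ Finset.range N, x n * t ^ n ≤ x 0 + x 1 * t + 16 * t ^ 2 := by
    have h2 := hS N (1 / 2) (by norm_num) (by norm_num)
    norm_num at h2
    -- for `n ≥ 2` and `t ≤ 1 / 2` one has `t ^ n ≤ 4 * t ^ 2 * (1 / 2) ^ n`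
    have hterm : ∀ n, x n * t ^ n ≤
        4 * t ^ 2 * (x n * (1 / 2) ^ n) + if n < 2 then x n * t ^ n else 0 := by
      intro n
      split_ifs with hn
      · have : (0 : ℝ) ≤ (1 / 2) ^ n := by positivity
        nlinarith [mul_nonneg (sq_nonneg t) (mul_nonneg (hx n) this)]
      · obtain ⟨k, rfl⟩ := Nat.exists_eq_add_of_le (not_lt.mp hn)
        have hk : t ^ k ≤ (1 / 2) ^ k := pow_le_pow_left₀ ht0 (by linarith) k
        have := mul_le_mul_of_nonneg_left hk (mul_nonneg (hx (2 + k)) (sq_nonneg t))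
        rw [pow_add, pow_add]
        linarith
    calc ∑ n ∈ Finset.range N, x n * t ^ n
        ≤ ∑ n ∈ Finset.range N, (4 * t ^ 2 * (x n * (1 / 2) ^ n) +
            if n < 2 then x n * t ^ n else 0) := Finset.sum_le_sum fun n _ => hterm n
      _ ≤ 4 * t ^ 2 * 4 + (x 0 + x 1 * t) := by
          rw [Finset.sum_add_distrib, ← Finset.mul_sum]
          refine add_le_add (mul_le_mul_of_nonneg_left (by simpa using h2) (by positivity)) ?_
          rw [← Finset.sum_filter]
          calc ∑ n ∈ Finset.range N with n < 2, x n * t ^ n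
              ≤ ∑ n ∈ Finset.range 2, x n * t ^ n := by
                refine Finset.sum_le_sum_of_subset_of_nonneg (fun n hn => ?_) fun n _ _ =>
                  mul_nonneg (hx n) (pow_nonneg ht0 n)
                simp at hn ⊢
                exact hn.2
            _ = x 0 + x 1 * t := by simp [Finset.sum_range_succ]
      _ = x 0 + x 1 * t + 16 * t ^ 2 := by ring
  -- either `x 0` is already away from `1`, or `hsq` at `t = 1 / 20` pushes `x 1` well below `2`
  have hgap : x 0 + x 1 * t + 16 * t ^ 2 ≤ 1 + 2 * t - 1 / 10000 := by
    rcases le_total (x 0) (199 / 200) with h | h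
    · nlinarith [mul_le_mul_of_nonneg_right hx1 ht0, mul_le_mul_of_nonneg_left ht2 ht0]
    · have h3 := hsq (1 / 20) (by norm_num) (by norm_num)
      have h4 : x 1 ≤ 6 / 5 := by
        have := hx 1
        norm_num at h3
        nlinarith [mul_le_mul_of_nonneg_right h this]
      nlinarith [mul_le_mul_of_nonneg_right h4 ht0, mul_le_mul_of_nonneg_left ht2 ht0]
  linarith

theorem integral_one_div_one_sub_sq {a b : ℝ} (hab : a ≤ b) (hb : b < 1) :
    IntervalIntegrable (fun s : ℝ => 1 / (1 - s) ^ 2) volume a b ∧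
    ∫ s in a..b, 1 / (1 - s) ^ 2 = 1 / (1 - b) - 1 / (1 - a) := by
  have hne : ∀ s ∈ Set.uIcc a b, 1 - s ≠ 0 := fun s hs => by
    rw [Set.uIcc_of_le hab] at hs
    linarith [hs.2]
  have hi : IntervalIntegrable (fun s : ℝ => 1 / (1 - s) ^ 2) volume a b := by
    refine ContinuousOn.intervalIntegrable ?_
    refine continuousOn_const.div (by fun_prop) fun s hs => pow_ne_zero 2 (hne s hs)
  refine ⟨hi, intervalIntegral.integral_eq_sub_of_hasDerivAt (f := fun s => 1 / (1 - s))
    (fun s hs => ?_) hi⟩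
  have := ((hasDerivAt_id s).const_sub 1).fun_inv (hne s hs)
  simpa [one_div] using this

/-- Integrating the bound `∑ x n * s ^ n ≤ 1 / (1 - s) ^ 2` over `[0, t]` gives
`∑ x n * t ^ (n + 1) / (n + 1) ≤ t / (1 - t)`; the gap on `[1 / 4000, 1 / 2000]` survives when `t`
lies beyond this interval. -/
theorem sum_primitive_le {x : ℕ → ℝ} (hx : ∀ n, 0 ≤ x n)
    (hS : ∀ (N : ℕ) (t : ℝ), 0 ≤ t → t < 1 →
      ∑ n ∈ Finset.range N, x n * t ^ n ≤ 1 / (1 - t) ^ 2)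
    (hsq : ∀ t : ℝ, 0 ≤ t → t < 1 → x 0 ^ 2 + 4 * x 0 * x 1 * t ≤ 1 / (1 - t) ^ 4)
    (N : ℕ) {t : ℝ} (ht0 : 0 ≤ t) (ht1 : t < 1) :
    ∑ n ∈ Finset.range N, x n * t ^ (n + 1) / (n + 1) ≤
      t / (1 - t) - if 1 / 2 ≤ t then 1 / 40000000 else 0 := by
  set S : ℝ → ℝ := fun s => ∑ n ∈ Finset.range N, x n * s ^ n with hSdef
  have hSc : Continuous S := by fun_prop
  have hSi : ∀ a b, IntervalIntegrable S volume a b := fun a b => hSc.intervalIntegrable a b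
  have hint : ∫ s in (0 : ℝ)..t, S s = ∑ n ∈ Finset.range N, x n * t ^ (n + 1) / (n + 1) := by
    rw [hSdef, intervalIntegral.integral_finsetSum fun n _ =>
      Continuous.intervalIntegrable (by fun_prop) _ _]
    refine Finset.sum_congr rfl fun n _ => ?_
    rw [intervalIntegral.integral_const_mul, integral_pow]
    simp [mul_div_assoc]
  have hpiece : ∀ a b : ℝ, 0 ≤ a → a ≤ b → b < 1 →
      ∫ s in a..b, S s ≤ 1 / (1 - b) - 1 / (1 - a) := by
    intro a b ha hab hb
    rw [← (integral_one_div_one_sub_sq hab hb).2]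
    exact intervalIntegral.integral_mono_on hab (hSi a b) (integral_one_div_one_sub_sq hab hb).1
      fun s hs => hS N s (ha.trans hs.1) (hs.2.trans_lt hb)
  have htt : t / (1 - t) = 1 / (1 - t) - 1 / (1 - 0) := by
    have : 1 - t ≠ 0 := by linarith
    field_simp
    ring
  rw [← hint, htt]
  split_ifs with h
  · -- `1 / 40000000` is the gap `1 / 10000` times the length `1 / 4000` of the interval
    have hmid : ∫ s in (1 / 4000 : ℝ)..(1 / 2000), S s ≤
        1 / (1 - 1 / 2000) - 1 / (1 - 1 / 4000) - 1 / 40000000 := by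
      have hi := integral_one_div_one_sub_sq (a := 1 / 4000) (b := 1 / 2000) (by norm_num)
        (by norm_num)
      calc ∫ s in (1 / 4000 : ℝ)..(1 / 2000), S s
          ≤ ∫ s in (1 / 4000 : ℝ)..(1 / 2000), (1 / (1 - s) ^ 2 - 1 / 10000) :=
            intervalIntegral.integral_mono_on (by norm_num) (hSi _ _)
              (hi.1.sub intervalIntegrable_const)
              fun s hs => sum_mul_pow_le_sub hx hS hsq N hs.1 hs.2
        _ = _ := by
          rw [intervalIntegral.integral_sub hi.1 intervalIntegrable_const, hi.2]
          norm_num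
    have h1 := hpiece 0 (1 / 4000) le_rfl (by norm_num) (by norm_num)
    have h2 := hpiece (1 / 2000) t (by norm_num) (by linarith) ht1
    have e1 := intervalIntegral.integral_add_adjacent_intervals (hSi 0 (1 / 4000))
      (hSi (1 / 4000) (1 / 2000))
    have e2 := intervalIntegral.integral_add_adjacent_intervals (hSi 0 (1 / 2000))
      (hSi (1 / 2000) t)
    linarith
  · simpa using hpiece 0 t le_rfl ht0 ht1

/-- A second integration against `(1 - t) / t` turns the gap into a constant smaller than `1`;
without the gap the bound would be `∑ 1 / ((n + 1) * (n + 2)) = 1`. The loss `1 / 320000000` is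
`1 / 40000000` times the integral of `1 - t` over `[1 / 2, 1]`. -/
theorem sum_div_le_of_sum_mul_pow_le {x : ℕ → ℝ} (hx : ∀ n, 0 ≤ x n)
    (hS : ∀ (N : ℕ) (t : ℝ), 0 ≤ t → t < 1 →
      ∑ n ∈ Finset.range N, x n * t ^ n ≤ 1 / (1 - t) ^ 2)
    (hsq : ∀ t : ℝ, 0 ≤ t → t < 1 → x 0 ^ 2 + 4 * x 0 * x 1 * t ≤ 1 / (1 - t) ^ 4)
    (N : ℕ) :
    ∑ n ∈ Finset.range N, x n / ((n + 1) ^ 2 * (n + 2)) ≤ 1 - 1 / 320000000 := by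
  set Q : ℝ → ℝ := fun t => ∑ n ∈ Finset.range N, x n / (n + 1) * (t ^ n - t ^ (n + 1)) with hQ
  have hQc : Continuous Q := by fun_prop
  have hQi : ∀ a b, IntervalIntegrable Q volume a b := fun a b => hQc.intervalIntegrable a b
  have hint : ∫ t in (0 : ℝ)..1, Q t = ∑ n ∈ Finset.range N, x n / ((n + 1) ^ 2 * (n + 2)) := by
    rw [hQ, intervalIntegral.integral_finsetSum fun n _ =>
      Continuous.intervalIntegrable (by fun_prop) _ _]
    refine Finset.sum_congr rfl fun n _ => ?_
    rw [intervalIntegral.integral_const_mul, intervalIntegral.integral_sub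
      (Continuous.intervalIntegrable (by fun_prop) _ _)
      (Continuous.intervalIntegrable (by fun_prop) _ _), integral_pow, integral_pow]
    have h1 : (n : ℝ) + 1 ≠ 0 := by positivity
    have h2 : (n : ℝ) + 2 ≠ 0 := by positivity
    push_cast
    have h3 : (n : ℝ) + 1 + 1 ≠ 0 := by positivity
    simp only [one_pow, zero_pow (Nat.succ_ne_zero _)]
    field_simp
    ring
  have hQle : ∀ t : ℝ, 0 < t → t < 1 →
      Q t ≤ 1 - if 1 / 2 ≤ t then 1 / 40000000 * (1 - t) else 0 := by
    intro t ht0 ht1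
    have h := sum_primitive_le hx hS hsq N ht0.le ht1
    have e : t * Q t = (1 - t) * ∑ n ∈ Finset.range N, x n * t ^ (n + 1) / (n + 1) := by
      rw [hQ, Finset.mul_sum, Finset.mul_sum]
      refine Finset.sum_congr rfl fun n _ => ?_
      ring
    have h1t : 0 < 1 - t := by linarith
    have h' := mul_le_mul_of_nonneg_left h h1t.le
    rw [← e, mul_sub, mul_div_cancel₀ _ h1t.ne'] at h'
    split_ifs at h' ⊢ with hh
    · refine le_of_mul_le_mul_left (h'.trans ?_) ht0
      nlinarith
    · refine le_of_mul_le_mul_left (h'.trans ?_) ht0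
      linarith
  have hA : ∫ t in (0 : ℝ)..(1 / 2), Q t ≤ 1 / 2 := by
    have := intervalIntegral.integral_mono_on_of_le_Ioo (g := fun _ => (1 : ℝ))
      (by norm_num : (0 : ℝ) ≤ 1 / 2) (hQi 0 (1 / 2))
      intervalIntegrable_const fun t ht => by
        have := hQle t ht.1 (by linarith [ht.2])
        rwa [if_neg (by linarith [ht.2]), sub_zero] at this
    simpa using this
  have hB : ∫ t in (1 / 2 : ℝ)..1, Q t ≤ 1 / 2 - 1 / 320000000 := by
    have hc : Continuous fun t : ℝ => 1 - 1 / 40000000 * (1 - t) := by fun_prop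
    have := intervalIntegral.integral_mono_on_of_le_Ioo
      (g := fun t => 1 - 1 / 40000000 * (1 - t))
      (by norm_num : (1 / 2 : ℝ) ≤ 1) (hQi (1 / 2) 1)
      (hc.intervalIntegrable _ _) fun t ht => by
        have := hQle t (by linarith [ht.1]) ht.2
        rwa [if_pos ht.1.le] at this
    refine this.trans (le_of_eq ?_)
    have e : ∀ t : ℝ, 1 - 1 / 40000000 * (1 - t) = (1 - 1 / 40000000) + 1 / 40000000 * t := by
      intro t; ring
    simp_rw [e]
    rw [intervalIntegral.integral_add intervalIntegrable_const
      (Continuous.intervalIntegrable (by fun_prop) _ _), intervalIntegral.integral_const_mul,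
      integral_id, intervalIntegral.integral_const]
    norm_num
  rw [← hint, ← intervalIntegral.integral_add_adjacent_intervals (hQi 0 (1 / 2)) (hQi (1 / 2) 1)]
  linarith

/-! ### Taylor coefficients and growth of Bloch functions -/

/-- The `n`-th Taylor coefficient of `f` at the origin. -/
noncomputable def taylorCoeff (f : ℂ → ℂ) (n : ℕ) : ℂ :=
  (n.factorial : ℂ)⁻¹ * iteratedDeriv n f 0

@[simp] theorem taylorCoeff_zero (f : ℂ → ℂ) : taylorCoeff f 0 = f 0 := by
  simp [taylorCoeff]

@[simp] theorem taylorCoeff_one (f : ℂ → ℂ) : taylorCoeff f 1 = deriv f 0 := by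
  simp [taylorCoeff]

theorem taylorCoeff_deriv (f : ℂ → ℂ) (n : ℕ) :
    taylorCoeff (deriv f) n = (n + 1) * taylorCoeff f (n + 1) := by
  rw [taylorCoeff, taylorCoeff, iteratedDeriv_succ', Nat.factorial_succ]
  have : (n : ℂ) + 1 ≠ 0 := by exact_mod_cast n.succ_ne_zero
  push_cast
  field_simp

theorem hasSum_taylorCoeff {f : ℂ → ℂ} (hf : DifferentiableOn ℂ f (Metric.ball 0 1)) {z : ℂ}
    (hz : ‖z‖ < 1) : HasSum (fun n => taylorCoeff f n * z ^ n) (f z) := by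
  have := Complex.hasSum_taylorSeries_on_ball hf (z := z) (by simpa using hz)
  simp only [sub_zero, smul_eq_mul] at this
  refine this.congr_fun fun n => ?_
  rw [taylorCoeff]
  ring

/-- **Parseval's identity** on the circle of radius `r < 1`. -/
theorem hasSum_sq_norm_taylorCoeff {f : ℂ → ℂ} (hf : DifferentiableOn ℂ f (Metric.ball 0 1))
    {r : ℝ} (hr0 : 0 ≤ r) (hr1 : r < 1) :
    HasSum (fun n => 2 * Real.pi * (‖taylorCoeff f n‖ ^ 2 * (r ^ 2) ^ n))
      (∫ θ in (-Real.pi)..Real.pi, ‖f (r * Complex.exp (θ * Complex.I))‖ ^ 2) := by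
  have hsum : Summable fun n => ‖taylorCoeff f n * (r : ℂ) ^ n‖ :=
    (hasSum_taylorCoeff hf (z := r) (by simpa [abs_of_nonneg hr0] using hr1)).summable.norm
  have := hasSum_sq_norm_of_summable hsum
    (F := fun θ => f (r * Complex.exp (θ * Complex.I))) fun θ => by
      have := hasSum_taylorCoeff hf (z := r * Complex.exp (θ * Complex.I))
        (by simpa [abs_of_nonneg hr0, Complex.norm_exp_ofReal_mul_I] using hr1)
      simpa only [mul_pow, mul_assoc] using this
  refine this.congr_fun fun n => ?_
  rw [norm_mul, norm_pow, Complex.norm_real, mul_pow, Real.norm_of_nonneg hr0, pow_right_comm]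

/-- Bessel's inequality for a function bounded by `M` on the circle `|z|² = t`. -/
theorem sum_sq_norm_taylorCoeff_le {f : ℂ → ℂ} (hf : DifferentiableOn ℂ f (Metric.ball 0 1))
    {t M : ℝ} (ht0 : 0 ≤ t) (ht1 : t < 1) (hM : ∀ z : ℂ, ‖z‖ ^ 2 = t → ‖f z‖ ^ 2 ≤ M) (N : ℕ) :
    ∑ n ∈ Finset.range N, ‖taylorCoeff f n‖ ^ 2 * t ^ n ≤ M := by
  have hr1 : √t < 1 := by rwa [Real.sqrt_lt' one_pos, one_pow]
  have h := hasSum_sq_norm_taylorCoeff hf (Real.sqrt_nonneg t) hr1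
  rw [Real.sq_sqrt ht0] at h
  have h1 := sum_le_hasSum (Finset.range N) (fun n _ => by positivity) h
  have h2 : ∫ θ in (-Real.pi)..Real.pi, ‖f (√t * Complex.exp (θ * Complex.I))‖ ^ 2 ≤
      2 * Real.pi * M := by
    have := intervalIntegral.norm_integral_le_of_norm_le_const (a := -Real.pi) (b := Real.pi)
      (f := fun θ : ℝ => ‖f (√t * Complex.exp (θ * Complex.I))‖ ^ 2) (C := M) fun θ _ => by
        rw [Real.norm_of_nonneg (by positivity)]
        refine hM _ ?_
        simp [Complex.norm_exp_ofReal_mul_I, abs_of_nonneg, ht0]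
    refine (le_abs_self _).trans (this.trans (le_of_eq ?_))
    rw [abs_of_nonneg (by linarith [Real.pi_pos])]
    ring
  rw [← Finset.mul_sum] at h1
  exact le_of_mul_le_mul_left (h1.trans h2) (by positivity)

/-- The unit ball of the Bloch space modulo constants: `g` is holomorphic in the unit disk,
vanishes at the origin, and has Bloch seminorm at most `1`. -/
structure IsBlochUnit (g : ℂ → ℂ) : Prop where
  differentiableOn : DifferentiableOn ℂ g (Metric.ball 0 1)
  map_zero : g 0 = 0
  norm_deriv_le : ∀ z : ℂ, ‖z‖ < 1 → ‖deriv g z‖ * (1 - ‖z‖ ^ 2) ≤ 1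

namespace IsBlochUnit

variable {g : ℂ → ℂ}

theorem norm_deriv_le_div (hg : IsBlochUnit g) {z : ℂ} (hz : ‖z‖ < 1) :
    ‖deriv g z‖ ≤ 1 / (1 - ‖z‖ ^ 2) := by
  rw [le_div_iff₀ (by nlinarith [norm_nonneg z])]
  exact hg.norm_deriv_le z hz

theorem differentiableOn_deriv (hg : IsBlochUnit g) :
    DifferentiableOn ℂ (deriv g) (Metric.ball 0 1) :=
  hg.differentiableOn.deriv Metric.isOpen_ball

theorem sum_sq_deriv_le (hg : IsBlochUnit g) (N : ℕ) (t : ℝ) (ht0 : 0 ≤ t) (ht1 : t < 1) :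
    ∑ n ∈ Finset.range N, ‖taylorCoeff (deriv g) n‖ ^ 2 * t ^ n ≤ 1 / (1 - t) ^ 2 := by
  refine sum_sq_norm_taylorCoeff_le hg.differentiableOn_deriv ht0 ht1 (fun z hz => ?_) N
  have h1 : ‖z‖ < 1 := by nlinarith [norm_nonneg z]
  have := pow_le_pow_left₀ (norm_nonneg _) (hg.norm_deriv_le_div h1) 2
  rwa [div_pow, one_pow, hz] at this

/-- The first two terms of Bessel's inequality for the square of `g'`. -/
theorem sq_deriv_sq_le (hg : IsBlochUnit g) (t : ℝ) (ht0 : 0 ≤ t) (ht1 : t < 1) :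
    (‖taylorCoeff (deriv g) 0‖ ^ 2) ^ 2 +
      4 * ‖taylorCoeff (deriv g) 0‖ ^ 2 * ‖taylorCoeff (deriv g) 1‖ ^ 2 * t ≤
        1 / (1 - t) ^ 4 := by
  have hd := hg.differentiableOn_deriv
  have h := sum_sq_norm_taylorCoeff_le (hd.fun_pow 2) (M := 1 / (1 - t) ^ 4) ht0 ht1
    (fun z hz => ?_) 2
  · simp only [Finset.sum_range_succ, Finset.sum_range_zero, taylorCoeff_zero,
      taylorCoeff_one] at h ⊢
    have h0 : DifferentiableAt ℂ (deriv g) 0 :=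
      hd.differentiableAt (Metric.isOpen_ball.mem_nhds (by simp))
    rw [deriv_fun_pow h0] at h
    simp only [norm_mul, norm_pow] at h
    norm_num at h
    norm_num
    nlinarith
  · have h1 : ‖z‖ < 1 := by nlinarith [norm_nonneg z]
    have := pow_le_pow_left₀ (norm_nonneg _) (hg.norm_deriv_le_div h1) 4
    rw [div_pow, one_pow, hz] at this
    rw [norm_pow, ← pow_mul]
    exact this

/-- The coefficient form of the `L²` bound for the unweighted area measure; the constant is
strictly below `1` uniformly in `g`. -/
theorem sum_sq_taylorCoeff_div_le (hg : IsBlochUnit g) (N : ℕ) :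
    ∑ n ∈ Finset.range N, ‖taylorCoeff g n‖ ^ 2 / (n + 1) ≤ 1 - 1 / 320000000 := by
  rcases N with _ | N
  · norm_num
  rw [Finset.sum_range_succ']
  have h := sum_div_le_of_sum_mul_pow_le (x := fun n => ‖taylorCoeff (deriv g) n‖ ^ 2)
    (fun n => by positivity) hg.sum_sq_deriv_le hg.sq_deriv_sq_le N
  simp only [taylorCoeff_zero, hg.map_zero, norm_zero]
  refine le_trans (le_of_eq ?_) h
  norm_num
  refine Finset.sum_congr rfl fun n _ => ?_
  have h1 : (n : ℝ) + 1 ≠ 0 := by positivity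
  have h2 : (n : ℝ) + 2 ≠ 0 := by positivity
  have h3 : (n : ℝ) + 1 + 1 ≠ 0 := by positivity
  have h4 : ‖(n : ℂ) + 1‖ = n + 1 := by
    rw [← Nat.cast_add_one, Complex.norm_natCast, Nat.cast_add_one]
  rw [taylorCoeff_deriv, norm_mul, h4, mul_pow]
  field_simp
  ring

end IsBlochUnit

theorem hasDerivAt_artanh {x : ℝ} (h0 : -1 < x) (h1 : x < 1) :
    HasDerivAt Real.artanh (1 / (1 - x ^ 2)) x := by
  have hp : 0 < 1 + x := by linarith
  have hm : 0 < 1 - x := by linarith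
  have h : HasDerivAt (fun y : ℝ => 1 / 2 * (Real.log (1 + y) - Real.log (1 - y)))
      (1 / 2 * (1 / (1 + x) - (-1) / (1 - x))) x :=
    ((((hasDerivAt_id x).const_add 1).log hp.ne').sub
      (((hasDerivAt_id x).const_sub 1).log hm.ne')).const_mul _
  have e : 1 / 2 * (1 / (1 + x) - (-1) / (1 - x)) = 1 / (1 - x ^ 2) := by
    have : 1 - x ^ 2 ≠ 0 := by nlinarith
    field_simp
    ring
  rw [e] at h
  refine h.congr_of_eventuallyEq ?_
  filter_upwards [Ioo_mem_nhds h0 h1] with y hy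
  rw [Real.artanh_eq_half_log ⟨hy.1.le, hy.2.le⟩,
    Real.log_div (by linarith [hy.1]) (by linarith [hy.2])]

/-- The sharp growth estimate for Bloch functions, by integrating `g'` along a radius. -/
theorem IsBlochUnit.norm_le_artanh {g : ℂ → ℂ} (hg : IsBlochUnit g) {z : ℂ} (hz : ‖z‖ < 1) :
    ‖g z‖ ≤ Real.artanh ‖z‖ := by
  rcases eq_or_ne z 0 with rfl | hz0
  · simp [hg.map_zero]
  set u : ℂ := z / ‖z‖ with hu
  have hnz : (‖z‖ : ℂ) ≠ 0 := by simpa using hz0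
  have hu1 : ‖u‖ = 1 := by simp [hu, hz0]
  have hsu : ∀ s ∈ Set.Icc (0 : ℝ) ‖z‖, ‖(s : ℂ) * u‖ = s := fun s hs => by
    simp [hu1, abs_of_nonneg hs.1]
  have hlt : ∀ s ∈ Set.Icc (0 : ℝ) ‖z‖, ‖(s : ℂ) * u‖ < 1 := fun s hs =>
    (hsu s hs).trans_lt (hs.2.trans_lt hz)
  have hder : ∀ s ∈ Set.Icc (0 : ℝ) ‖z‖,
      HasDerivAt (fun s : ℝ => g (s * u)) (deriv g (s * u) * u) s := fun s hs => by
    have h1 : HasDerivAt g (deriv g (s * u)) ((s : ℂ) * u) :=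
      (hg.differentiableOn.differentiableAt
        (Metric.isOpen_ball.mem_nhds (by simpa using hlt s hs))).hasDerivAt
    have h2 : HasDerivAt (fun s : ℝ => (s : ℂ) * u) u s := by
      simpa using ((hasDerivAt_id s).ofReal_comp).mul_const u
    exact h1.comp s h2
  have hB : ∀ s ∈ Set.Icc (0 : ℝ) ‖z‖, HasDerivAt Real.artanh (1 / (1 - s ^ 2)) s := fun s hs =>
    hasDerivAt_artanh (by linarith [hs.1]) (hs.2.trans_lt hz)
  have h := image_norm_le_of_norm_deriv_right_le_deriv_boundary'
    (f := fun s : ℝ => g (s * u)) (B := Real.artanh) (B' := fun s => 1 / (1 - s ^ 2))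
    (fun s hs => (hder s hs).continuousAt.continuousWithinAt)
    (fun s hs => (hder s (Set.Ico_subset_Icc_self hs)).hasDerivWithinAt)
    (by simp [hg.map_zero])
    (fun s hs => (hB s hs).continuousAt.continuousWithinAt)
    (fun s hs => (hB s (Set.Ico_subset_Icc_self hs)).hasDerivWithinAt)
    (fun s hs => by
      have hs' := Set.Ico_subset_Icc_self hs
      have := hg.norm_deriv_le_div (hlt s hs')
      rw [hsu s hs'] at this
      rwa [norm_mul, hu1, mul_one])
    (Set.right_mem_Icc.mpr (norm_nonneg z))
  have e : (‖z‖ : ℂ) * u = z := by rw [hu]; field_simp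
  simpa [e] using h

/-! ### Moments of the extremal growth function -/

theorem one_sub_sq_pos {r : ℝ} (h0 : 0 ≤ r) (h1 : r < 1) : 0 < 1 - r ^ 2 := by nlinarith

theorem continuous_one_sub_sq_rpow {α : ℝ} (hα : 0 ≤ α) :
    Continuous fun r : ℝ => (1 - r ^ 2) ^ α :=
  Continuous.rpow_const (by fun_prop) fun _ => Or.inr hα

theorem hasDerivAt_one_sub_sq_rpow {α : ℝ} (hα : 0 ≤ α) (r : ℝ) :
    HasDerivAt (fun r : ℝ => (1 - r ^ 2) ^ (α + 1)) (-(2 * (α + 1) * r * (1 - r ^ 2) ^ α)) r := by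
  have h := ((hasDerivAt_pow 2 r).const_sub 1).rpow_const (p := α + 1) (Or.inr (by linarith))
  convert! h using 1
  rw [add_sub_cancel_right]
  push_cast
  ring

/-- Logarithmic growth of `artanh` at `1` is dominated by every negative power of `1 - r`. -/
theorem artanh_rpow_le {p : ℝ} (hp : 0 < p) {r : ℝ} (h0 : 0 ≤ r) (h1 : r < 1) :
    Real.artanh r ^ p ≤ p ^ p * 2 ^ (1 / 2 : ℝ) * (1 - r) ^ (-(1 / 2) : ℝ) := by
  have h1r : 0 < 1 - r := by linarith
  have hlog : Real.artanh r ≤ p * (2 / (1 - r)) ^ (1 / (2 * p)) := by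
    rw [Real.artanh_eq_half_log ⟨by linarith, h1.le⟩]
    have hl : Real.log ((1 + r) / (1 - r)) ≤ Real.log (2 / (1 - r)) :=
      Real.log_le_log (by positivity) (by gcongr; linarith)
    have := Real.log_le_rpow_div (x := 2 / (1 - r)) (by positivity)
      (show 0 < 1 / (2 * p) by positivity)
    calc 1 / 2 * Real.log ((1 + r) / (1 - r))
        ≤ 1 / 2 * ((2 / (1 - r)) ^ (1 / (2 * p)) / (1 / (2 * p))) := by linarith
      _ = p * (2 / (1 - r)) ^ (1 / (2 * p)) := by field_simp
  calc Real.artanh r ^ p ≤ (p * (2 / (1 - r)) ^ (1 / (2 * p))) ^ p :=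
        Real.rpow_le_rpow (Real.artanh_nonneg h0) hlog hp.le
    _ = p ^ p * 2 ^ (1 / 2 : ℝ) * (1 - r) ^ (-(1 / 2) : ℝ) := by
        rw [Real.mul_rpow hp.le (by positivity), ← Real.rpow_mul (by positivity),
          show 1 / (2 * p) * p = 1 / 2 by field_simp, Real.div_rpow (by norm_num) h1r.le,
          Real.rpow_neg h1r.le]
        ring

theorem continuousOn_artanh_rpow {p : ℝ} (hp : 0 ≤ p) :
    ContinuousOn (fun r => Real.artanh r ^ p) (Set.Ico 0 1) := fun r hr =>
  ((hasDerivAt_artanh (by linarith [hr.1]) hr.2).continuousAt.rpow_const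
    (Or.inr hp)).continuousWithinAt

theorem intervalIntegrable_artanh_rpow {p : ℝ} (hp : 0 < p) :
    IntervalIntegrable (fun r => Real.artanh r ^ p) volume 0 1 := by
  have h1 : IntervalIntegrable
      (fun r : ℝ => p ^ p * 2 ^ (1 / 2 : ℝ) * (1 - r) ^ (-(1 / 2) : ℝ)) volume 0 1 := by
    have h := (intervalIntegral.intervalIntegrable_rpow' (a := 0) (b := 1)
      (r := -(1 / 2)) (by norm_num)).comp_sub_left 1
    simp only [sub_zero, sub_self] at h
    exact h.symm.const_mul _
  rw [intervalIntegrable_iff_integrableOn_Ioo_of_le zero_le_one] at h1 ⊢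
  refine Integrable.mono' h1 ?_ ?_
  · exact ((continuousOn_artanh_rpow hp.le).mono Set.Ioo_subset_Ico_self).aestronglyMeasurable
      measurableSet_Ioo
  · refine (ae_restrict_iff' measurableSet_Ioo).mpr (Filter.Eventually.of_forall fun r hr => ?_)
    rw [Real.norm_of_nonneg (Real.rpow_nonneg (Real.artanh_nonneg hr.1.le) _)]
    exact artanh_rpow_le hp hr.1.le hr.2

/-- The `p`-th moment of `artanh |z|`, the extremal growth of Bloch functions, with respect to
`μ_α`, written in the radial variable. -/
noncomputable def artanhMoment (α p : ℝ) : ℝ :=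
  ∫ r in (0 : ℝ)..1, 2 * (α + 1) * r * (1 - r ^ 2) ^ α * Real.artanh r ^ p

theorem continuous_radialWeight {α : ℝ} (hα : 0 ≤ α) :
    Continuous fun r : ℝ => 2 * (α + 1) * r * (1 - r ^ 2) ^ α :=
  (by fun_prop : Continuous fun r : ℝ => 2 * (α + 1) * r).mul (continuous_one_sub_sq_rpow hα)

theorem intervalIntegrable_artanhMoment {α p : ℝ} (hα : 0 ≤ α) (hp : 0 < p) :
    IntervalIntegrable (fun r => 2 * (α + 1) * r * (1 - r ^ 2) ^ α * Real.artanh r ^ p)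
      volume 0 1 :=
  (intervalIntegrable_artanh_rpow hp).continuousOn_mul (continuous_radialWeight hα).continuousOn

theorem artanhMoment_nonneg {α p : ℝ} (hα : 0 ≤ α) : 0 ≤ artanhMoment α p := by
  refine intervalIntegral.integral_nonneg zero_le_one fun r hr => ?_
  have h1 : 0 ≤ 1 - r ^ 2 := by nlinarith [hr.1, hr.2]
  have := hr.1
  have := Real.artanh_nonneg hr.1
  positivity

theorem integral_radialWeight {α : ℝ} (hα : 0 ≤ α) :
    ∫ r in (0 : ℝ)..1, 2 * (α + 1) * r * (1 - r ^ 2) ^ α = 1 := by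
  have h := intervalIntegral.integral_eq_sub_of_hasDerivAt (a := 0) (b := 1)
    (fun r _ => hasDerivAt_one_sub_sq_rpow hα r)
    ((continuous_radialWeight hα).neg.intervalIntegrable _ _)
  rw [intervalIntegral.integral_neg] at h
  rw [← neg_inj, h]
  simp [Real.zero_rpow (by linarith : α + 1 ≠ 0)]

/-- The moments of `|z|²` with respect to `μ_α` are largest for `α = 0`. -/
theorem integral_radialWeight_mul_pow_le {α : ℝ} (hα : 0 ≤ α) (n : ℕ) :
    ∫ r in (0 : ℝ)..1, 2 * (α + 1) * r * (1 - r ^ 2) ^ α * (r ^ 2) ^ n ≤ 1 / ((n : ℝ) + 1) := by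
  -- after an integration by parts `α` enters only through `(1 - r²)^(α + 1) ≤ 1 - r²`
  have hc := continuous_radialWeight hα
  have hc1 := continuous_one_sub_sq_rpow (show 0 ≤ α + 1 by linarith)
  rcases n with _ | n
  · simp [integral_radialWeight hα]
  have hd : ∀ r : ℝ, HasDerivAt (fun r : ℝ => (r ^ 2) ^ (n + 1))
      (2 * (n + 1) * r * (r ^ 2) ^ n) r := fun r => by
    have := (hasDerivAt_pow 2 r).fun_pow (n + 1)
    convert! this using 1
    push_cast
    simp
    ring
  have hparts := intervalIntegral.integral_mul_deriv_eq_deriv_mul (a := 0) (b := 1)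
    (u := fun r : ℝ => (r ^ 2) ^ (n + 1)) (v := fun r : ℝ => (1 - r ^ 2) ^ (α + 1))
    (fun r _ => hd r) (fun r _ => hasDerivAt_one_sub_sq_rpow hα r)
    (Continuous.intervalIntegrable (by fun_prop) _ _) (hc.neg.intervalIntegrable _ _)
  have hle : ∫ r in (0 : ℝ)..1, 2 * (n + 1) * r * (r ^ 2) ^ n * (1 - r ^ 2) ^ (α + 1) ≤
      ∫ r in (0 : ℝ)..1, 2 * (n + 1) * r * (r ^ 2) ^ n * (1 - r ^ 2) := by
    refine intervalIntegral.integral_mono_on zero_le_one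
      ((Continuous.mul (by fun_prop) hc1).intervalIntegrable _ _)
      (Continuous.intervalIntegrable (by fun_prop) _ _) fun r hr => ?_
    have h1 : 0 ≤ 1 - r ^ 2 := by nlinarith [hr.1, hr.2]
    have h2 : (1 - r ^ 2) ^ (α + 1) ≤ 1 - r ^ 2 :=
      Real.rpow_le_self_of_le_one h1 (by nlinarith [hr.1]) (by linarith)
    have := hr.1
    exact mul_le_mul_of_nonneg_left h2 (by positivity)
  have heq : ∫ r in (0 : ℝ)..1, 2 * (n + 1) * r * (r ^ 2) ^ n * (1 - r ^ 2) =
      1 / ((n : ℝ) + 1 + 1) := by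
    have e : ∀ r : ℝ, 2 * (n + 1) * r * (r ^ 2) ^ n * (1 - r ^ 2) =
        2 * (n + 1) * r ^ (2 * n + 1) - 2 * (n + 1) * r ^ (2 * n + 3) := fun r => by ring
    simp_rw [e]
    rw [intervalIntegral.integral_sub (Continuous.intervalIntegrable (by fun_prop) _ _)
      (Continuous.intervalIntegrable (by fun_prop) _ _), intervalIntegral.integral_const_mul,
      intervalIntegral.integral_const_mul, integral_pow, integral_pow]
    simp only [one_pow, zero_pow (Nat.succ_ne_zero _)]
    push_cast
    have h1 : (n : ℝ) + 1 ≠ 0 := by positivity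
    have h2 : (n : ℝ) + 1 + 1 ≠ 0 := by positivity
    have h3 : 2 * (n : ℝ) + 1 + 1 ≠ 0 := by positivity
    have h4 : 2 * (n : ℝ) + 3 + 1 ≠ 0 := by positivity
    field_simp
    ring
  have hlhs : ∫ r in (0 : ℝ)..1, 2 * (α + 1) * r * (1 - r ^ 2) ^ α * (r ^ 2) ^ (n + 1) =
      -∫ r in (0 : ℝ)..1, (r ^ 2) ^ (n + 1) * -(2 * (α + 1) * r * (1 - r ^ 2) ^ α) := by
    rw [← intervalIntegral.integral_neg]
    refine intervalIntegral.integral_congr fun r _ => ?_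
    ring
  rw [hlhs, hparts, Nat.cast_add_one, ← heq]
  refine le_trans (le_of_eq ?_) hle
  simp [Real.zero_rpow (by linarith : α + 1 ≠ 0)]

/-- Integration by parts for the moments of `artanh`; the boundary terms vanish because
`(1 - r²)^(α+1)` beats the logarithmic growth at `r = 1`. -/
theorem artanhMoment_eq {α p : ℝ} (hα : 0 ≤ α) (hp : 1 < p) :
    artanhMoment α p = p * ∫ r in (0 : ℝ)..1, (1 - r ^ 2) ^ α * Real.artanh r ^ (p - 1) := by
  have hp0 : 0 < p := by linarith
  have hi1 := intervalIntegrable_artanhMoment hα hp0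
  have hi2 : IntervalIntegrable (fun r => p * ((1 - r ^ 2) ^ α * Real.artanh r ^ (p - 1)))
      volume 0 1 :=
    ((intervalIntegrable_artanh_rpow (by linarith)).continuousOn_mul
      (continuous_one_sub_sq_rpow hα).continuousOn).const_mul p
  have hcont : ContinuousOn (fun r : ℝ => (1 - r ^ 2) ^ (α + 1) * Real.artanh r ^ p)
      (Set.Icc 0 1) := by
    have hIco : ContinuousOn (fun r : ℝ => (1 - r ^ 2) ^ (α + 1) * Real.artanh r ^ p)
        (Set.Ico 0 1) :=
      (continuous_one_sub_sq_rpow (by linarith)).continuousOn.mul (continuousOn_artanh_rpow hp0.le)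
    intro r hr
    rcases hr.2.lt_or_eq with h | rfl
    · have h1 := hIco r ⟨hr.1, h⟩
      refine h1.mono_of_mem_nhdsWithin ?_
      filter_upwards [self_mem_nhdsWithin, mem_nhdsWithin_of_mem_nhds (Iio_mem_nhds h)]
        with s hs hs1 using ⟨hs.1, hs1⟩
    · have hz : (1 - (1 : ℝ) ^ 2) ^ (α + 1) * Real.artanh 1 ^ p = 0 := by
        simp [Real.zero_rpow (by linarith : α + 1 ≠ 0)]
      rw [ContinuousWithinAt, hz]
      set C : ℝ := p ^ p * 2 ^ (1 / 2 : ℝ) with hC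
      have hC0 : 0 ≤ C := by positivity
      have hlim : Filter.Tendsto (fun s : ℝ => 2 * C * (1 - s) ^ (1 / 2 : ℝ))
          (nhdsWithin 1 (Set.Icc 0 1)) (nhds 0) := by
        have hcc : Continuous fun s : ℝ => 2 * C * (1 - s) ^ (1 / 2 : ℝ) :=
          continuous_const.mul (Continuous.rpow_const (by fun_prop) fun _ => Or.inr (by norm_num))
        have := (hcc.tendsto 1).mono_left (nhdsWithin_le_nhds (s := Set.Icc 0 1))
        simpa using this
      refine squeeze_zero' ?_ ?_ hlim
      · filter_upwards [self_mem_nhdsWithin] with s hs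
        have h1 : 0 ≤ 1 - s ^ 2 := by nlinarith [hs.1, hs.2]
        have := Real.artanh_nonneg hs.1
        positivity
      · filter_upwards [self_mem_nhdsWithin] with s hs
        rcases hs.2.lt_or_eq with h | rfl
        · have h1 : 0 < 1 - s ^ 2 := one_sub_sq_pos hs.1 h
          have h1s : 0 < 1 - s := by linarith
          have h2 : (1 - s ^ 2) ^ (α + 1) ≤ 2 * (1 - s) :=
            (Real.rpow_le_self_of_le_one h1.le (by nlinarith [hs.1]) (by linarith)).trans
              (by nlinarith [hs.1])
          have h3 := artanh_rpow_le hp0 hs.1 h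
          have h4 : (1 - s) ^ (1 / 2 : ℝ) = (1 - s) * (1 - s) ^ (-(1 / 2) : ℝ) := by
            rw [← Real.rpow_one_add' h1s.le (by norm_num)]
            norm_num
          rw [h4]
          calc _ ≤ 2 * (1 - s) * (C * (1 - s) ^ (-(1 / 2) : ℝ)) :=
                mul_le_mul h2 h3 (Real.rpow_nonneg (Real.artanh_nonneg hs.1) _) (by linarith)
            _ = _ := by ring
        · rw [hz]; simp
  have hder : ∀ r ∈ Set.Ioo (0 : ℝ) 1,
      HasDerivAt (fun r : ℝ => (1 - r ^ 2) ^ (α + 1) * Real.artanh r ^ p)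
        (p * ((1 - r ^ 2) ^ α * Real.artanh r ^ (p - 1)) -
          2 * (α + 1) * r * (1 - r ^ 2) ^ α * Real.artanh r ^ p) r := fun r hr => by
    have hpos := one_sub_sq_pos hr.1.le hr.2
    have h := (hasDerivAt_one_sub_sq_rpow hα r).mul
      ((hasDerivAt_artanh (by linarith [hr.1]) hr.2).rpow_const (p := p) (Or.inr hp.le))
    convert! h using 1
    rw [Real.rpow_add_one hpos.ne']
    field_simp
    ring
  have h := intervalIntegral.integral_eq_sub_of_hasDerivAt_of_le zero_le_one hcont hder
    (hi2.sub hi1)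
  rw [intervalIntegral.integral_sub hi2 hi1, intervalIntegral.integral_const_mul] at h
  simp only [one_pow, sub_self, Real.artanh_zero, Real.zero_rpow hp0.ne',
    Real.zero_rpow (by linarith : α + 1 ≠ 0), zero_mul, mul_zero] at h
  rw [artanhMoment]
  linarith

theorem lt_integral_one_sub_sq_rpow {α : ℝ} (hα : 0 ≤ α) :
    1 < 2 * (α + 1) * ∫ r in (0 : ℝ)..1, (1 - r ^ 2) ^ α := by
  have hc := continuous_one_sub_sq_rpow hα
  have hc2 : Continuous fun r : ℝ => 2 * (α + 1) * (1 - r ^ 2) ^ α := continuous_const.mul hc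
  have hsub := intervalIntegral.integral_sub (hc2.intervalIntegrable (μ := volume) 0 1)
    ((continuous_radialWeight hα).intervalIntegrable 0 1)
  rw [integral_radialWeight hα, intervalIntegral.integral_const_mul] at hsub
  rw [← sub_pos, ← hsub]
  refine intervalIntegral.intervalIntegral_pos_of_pos_on
    ((hc2.sub (continuous_radialWeight hα)).intervalIntegrable _ _) (fun r hr => ?_) zero_lt_one
  have h1 := Real.rpow_pos_of_pos (one_sub_sq_pos hr.1.le hr.2) α
  have h2 : 0 < 1 - r := by linarith [hr.2]
  have : 0 < 2 * (α + 1) * (1 - r) * (1 - r ^ 2) ^ α := by positivity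
  linarith

/-- At the exponent `p = 1 / ∫ (1 - r²)^α` the extremal growth function has `p`-th moment below
`1`: by parts and Chebyshev's inequality the `p`-th moment is below the `(p-1)`-th one, and
Young's inequality bounds the latter by `((p - 1) * artanhMoment α p + 1) / p`. -/
theorem artanhMoment_lt_one {α p : ℝ} (hα : 0 ≤ α) (hp : 1 < p)
    (hpβ : p * ∫ r in (0 : ℝ)..1, (1 - r ^ 2) ^ α = 1) : artanhMoment α p < 1 := by
  have hp0 : 0 < p := by linarith
  have hp1 : 0 < p - 1 := by linarith
  have hα1 : 0 < 2 * (α + 1) := by linarith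
  have hc := continuous_one_sub_sq_rpow hα
  set β := ∫ r in (0 : ℝ)..1, (1 - r ^ 2) ^ α with hβ
  -- the point where the weights `2 (α + 1) r` and `p` cross
  set r₀ : ℝ := p / (2 * (α + 1)) with hr₀
  have hr₀0 : 0 < r₀ := by positivity
  have hr₀1 : r₀ < 1 := by
    rw [hr₀, div_lt_one hα1]
    have h := lt_integral_one_sub_sq_rpow hα
    rw [← hβ] at h
    have hβ0 : 0 < β := by
      by_contra hneg
      nlinarith
    nlinarith
  have hcross : ∀ r, 2 * (α + 1) * r - p = 2 * (α + 1) * (r - r₀) := fun r => by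
    rw [hr₀]
    field_simp
  set c : ℝ := Real.artanh r₀ ^ (p - 1) with hcdef
  have hi1 := intervalIntegrable_artanhMoment hα hp1
  have hi2 : IntervalIntegrable (fun r => (1 - r ^ 2) ^ α * Real.artanh r ^ (p - 1))
      volume 0 1 :=
    (intervalIntegrable_artanh_rpow hp1).continuousOn_mul hc.continuousOn
  set D : ℝ → ℝ := fun r =>
    (1 - r ^ 2) ^ α * (Real.artanh r ^ (p - 1) - c) * (2 * (α + 1) * r - p) with hD
  have hw : Continuous fun r : ℝ => c * (2 * (α + 1) * r * (1 - r ^ 2) ^ α) :=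
    continuous_const.mul (continuous_radialWeight hα)
  have hw' : Continuous fun r : ℝ => c * (p * (1 - r ^ 2) ^ α) :=
    continuous_const.mul (continuous_const.mul hc)
  have hDeq : D = fun r => (2 * (α + 1) * r * (1 - r ^ 2) ^ α * Real.artanh r ^ (p - 1) -
      p * ((1 - r ^ 2) ^ α * Real.artanh r ^ (p - 1))) -
      (c * (2 * (α + 1) * r * (1 - r ^ 2) ^ α) - c * (p * (1 - r ^ 2) ^ α)) := by
    ext r
    simp only [hD]
    ring
  have hDi : IntervalIntegrable D volume 0 1 := by
    rw [hDeq]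
    exact (hi1.sub (hi2.const_mul p)).sub
      ((hw.intervalIntegrable _ _).sub (hw'.intervalIntegrable _ _))
  have hDint : ∫ r in (0 : ℝ)..1, D r = artanhMoment α (p - 1) - artanhMoment α p := by
    rw [hDeq, intervalIntegral.integral_sub (hi1.sub (hi2.const_mul p))
      ((hw.intervalIntegrable _ _).sub (hw'.intervalIntegrable _ _)),
      intervalIntegral.integral_sub hi1 (hi2.const_mul p),
      intervalIntegral.integral_sub (hw.intervalIntegrable _ _) (hw'.intervalIntegrable _ _),
      intervalIntegral.integral_const_mul, intervalIntegral.integral_const_mul,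
      intervalIntegral.integral_const_mul, intervalIntegral.integral_const_mul,
      integral_radialWeight hα, ← artanhMoment_eq hα hp, ← hβ, hpβ, sub_self, sub_zero]
    rfl
  have hmono : ∀ r s : ℝ, 0 ≤ r → r < s → s < 1 →
      Real.artanh r ^ (p - 1) < Real.artanh s ^ (p - 1) := fun r s hr hrs hs =>
    Real.rpow_lt_rpow (Real.artanh_nonneg hr)
      (Real.artanh_lt_artanh (by linarith) hs hrs) hp1
  have hDpos : ∀ r ∈ Set.Ioo (0 : ℝ) 1, r ≠ r₀ → 0 < D r := fun r hr hne => by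
    have h1 := Real.rpow_pos_of_pos (one_sub_sq_pos hr.1.le hr.2) α
    simp only [hD]
    rw [hcross, mul_assoc]
    refine mul_pos h1 ?_
    rcases hne.lt_or_gt with h | h
    · exact mul_pos_of_neg_of_neg (sub_neg.mpr (hmono r r₀ hr.1.le h hr₀1))
        (mul_neg_of_pos_of_neg hα1 (sub_neg.mpr h))
    · exact mul_pos (sub_pos.mpr (hmono r₀ r hr₀0.le h hr.2)) (mul_pos hα1 (sub_pos.mpr h))
  have hlt : artanhMoment α p < artanhMoment α (p - 1) := by
    have ha : IntervalIntegrable D volume 0 r₀ := hDi.mono_set (by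
      rw [Set.uIcc_of_le hr₀0.le, Set.uIcc_of_le zero_le_one]
      exact Set.Icc_subset_Icc le_rfl hr₀1.le)
    have hb : IntervalIntegrable D volume r₀ 1 := hDi.mono_set (by
      rw [Set.uIcc_of_le hr₀1.le, Set.uIcc_of_le zero_le_one]
      exact Set.Icc_subset_Icc hr₀0.le le_rfl)
    have h1 := intervalIntegral.intervalIntegral_pos_of_pos_on ha
      (fun r hr => hDpos r ⟨hr.1, hr.2.trans hr₀1⟩ hr.2.ne) hr₀0
    have h2 := intervalIntegral.intervalIntegral_pos_of_pos_on hb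
      (fun r hr => hDpos r ⟨hr₀0.trans hr.1, hr.2⟩ hr.1.ne') hr₀1
    rw [← sub_pos, ← hDint, ← intervalIntegral.integral_add_adjacent_intervals ha hb]
    exact add_pos h1 h2
  have hyoung : p * artanhMoment α (p - 1) ≤ (p - 1) * artanhMoment α p + 1 := by
    have hip := intervalIntegrable_artanhMoment hα hp0
    have hw1 := (continuous_radialWeight hα).intervalIntegrable (μ := volume) 0 1
    have hadd := intervalIntegral.integral_add (hip.const_mul (p - 1)) hw1
    rw [integral_radialWeight hα, intervalIntegral.integral_const_mul] at hadd
    rw [artanhMoment, artanhMoment, ← intervalIntegral.integral_const_mul, ← hadd]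
    refine intervalIntegral.integral_mono_on zero_le_one (hi1.const_mul _)
      ((hip.const_mul _).add hw1) fun r hr => ?_
    have h1 : 0 ≤ 1 - r ^ 2 := by nlinarith [hr.1, hr.2]
    have h0 := hr.1
    have hA := Real.artanh_nonneg hr.1
    have hy : p * Real.artanh r ^ (p - 1) ≤ (p - 1) * Real.artanh r ^ p + 1 := by
      have := Real.geom_mean_le_arith_mean2_weighted (w₁ := (p - 1) / p) (w₂ := 1 / p)
        (p₁ := Real.artanh r ^ p) (p₂ := 1) (by positivity) (by positivity) (by positivity)
        zero_le_one (by field_simp; ring)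
      rw [← Real.rpow_mul hA, Real.one_rpow, mul_one, mul_div_cancel₀ _ hp0.ne'] at this
      have h := mul_le_mul_of_nonneg_left this hp0.le
      refine h.trans (le_of_eq ?_)
      field_simp
    have := mul_le_mul_of_nonneg_left hy
      (show 0 ≤ 2 * (α + 1) * r * (1 - r ^ 2) ^ α by positivity)
    linarith
  nlinarith

/-! ### Radial integration and the `L²` bound -/

theorem eulerBeta_half {α : ℝ} (hα : 0 ≤ α) :
    eulerBeta (1 / 2) (α + 1) = 2 * ∫ r in (0 : ℝ)..1, (1 - r ^ 2) ^ α := by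
  have hcα : Continuous fun t : ℝ => (1 - t) ^ α :=
    Continuous.rpow_const (by fun_prop) fun _ => Or.inr hα
  set G : ℝ → ℝ := fun t => t ^ ((1 / 2 : ℝ) - 1) * (1 - t) ^ (α + 1 - 1) with hG
  have hGα : G = fun t => t ^ ((1 / 2 : ℝ) - 1) * (1 - t) ^ α := by
    ext t; simp only [hG, add_sub_cancel_right]
  have hGi : IntervalIntegrable G volume 0 1 := by
    rw [hGα]
    exact (intervalIntegral.intervalIntegrable_rpow' (by norm_num)).mul_continuousOn
      hcα.continuousOn
  have hpt : ∀ r ∈ Set.Ioo (0 : ℝ) 1, (G ∘ fun r : ℝ => r ^ 2) r * (2 * r) =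
      2 * (1 - r ^ 2) ^ α := fun r hr => by
    have h : (r ^ 2) ^ ((1 / 2 : ℝ) - 1) = r⁻¹ := by
      rw [← Real.rpow_natCast, ← Real.rpow_mul hr.1.le, ← Real.rpow_neg_one]
      norm_num
    have := hr.1.ne'
    simp only [hGα, Function.comp, h]
    field_simp
  have himg : (fun r : ℝ => r ^ 2) '' Set.Icc 0 1 ⊆ Set.Icc 0 1 := by
    rintro _ ⟨r, hr, rfl⟩
    exact ⟨by positivity, by nlinarith [hr.1, hr.2]⟩
  have hu : Set.uIcc (0 : ℝ) 1 = Set.Icc 0 1 := Set.uIcc_of_le zero_le_one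
  have hsub := intervalIntegral.integral_comp_mul_deriv''' (a := 0) (b := 1)
    (f := fun r : ℝ => r ^ 2) (f' := fun r => 2 * r) (g := G) (by fun_prop)
    (fun r _ => by simpa using (hasDerivAt_pow 2 r).hasDerivWithinAt) ?_ ?_ ?_
  · rw [eulerBeta, ← intervalIntegral.integral_const_mul]
    simp only [one_pow, ne_eq, OfNat.ofNat_ne_zero, not_false_eq_true, zero_pow] at hsub
    rw [← hsub, intervalIntegral.integral_of_le zero_le_one,
      intervalIntegral.integral_of_le zero_le_one, integral_Ioc_eq_integral_Ioo,
      integral_Ioc_eq_integral_Ioo]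
    exact setIntegral_congr_fun measurableSet_Ioo hpt
  · rw [hGα]
    rintro _ ⟨r, hr, rfl⟩
    simp only [min_eq_left, max_eq_right, zero_le_one] at hr
    have h0 : r ^ 2 ≠ 0 := pow_ne_zero 2 hr.1.ne'
    exact ((Real.continuousAt_rpow_const _ _ (Or.inl h0)).mul
      hcα.continuousAt).continuousWithinAt
  · rw [hu]
    exact ((intervalIntegrable_iff_integrableOn_Icc_of_le zero_le_one).mp hGi).mono_set himg
  · rw [hu, integrableOn_Icc_iff_integrableOn_Ioo]
    have h1 : IntegrableOn (fun r : ℝ => 2 * (1 - r ^ 2) ^ α) (Set.Ioo 0 1) :=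
      ((continuous_const.mul (continuous_one_sub_sq_rpow hα)).integrableOn_Icc).mono_set
        Set.Ioo_subset_Icc_self
    exact h1.congr_fun (fun r hr => (hpt r hr).symm) measurableSet_Ioo

/-- Integration in polar coordinates with respect to `μ_α`. -/
theorem lintegral_bergmanMeasure (α : ℝ) {F : ℂ → ℝ≥0∞} (hF : Measurable F) :
    ∫⁻ z, F z ∂(bergmanMeasure α) = ∫⁻ r in Set.Ioo (0 : ℝ) 1,
      ENNReal.ofReal ((α + 1) / Real.pi * r * (1 - r ^ 2) ^ α) *
        ∫⁻ θ in Set.Ioo (-Real.pi) Real.pi, F (r * Complex.exp (θ * Complex.I)) := by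
  have hw : Measurable fun z : ℂ => ENNReal.ofReal ((α + 1) * (1 - ‖z‖ ^ 2) ^ α) := by fun_prop
  have hE : Measurable fun p : ℝ × ℝ => F (p.1 * Complex.exp (p.2 * Complex.I)) :=
    hF.comp (by fun_prop)
  rw [bergmanMeasure, lintegral_withDensity_eq_lintegral_mul _ hw hF, diskArea,
    lintegral_smul_measure, ← lintegral_indicator measurableSet_ball,
    ← Complex.lintegral_comp_polarCoord_symm]
  have htarget : polarCoord.target = Set.Ioi (0 : ℝ) ×ˢ Set.Ioo (-Real.pi) Real.pi := rfl
  have hms : MeasurableSet polarCoord.target := polarCoord.open_target.measurableSet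
  have hpt : ∀ p ∈ polarCoord.target, ENNReal.ofReal p.1 •
      (Metric.ball (0 : ℂ) 1).indicator
        ((fun z : ℂ => ENNReal.ofReal ((α + 1) * (1 - ‖z‖ ^ 2) ^ α)) * F)
        (Complex.polarCoord.symm p) =
      (Set.Ioo (0 : ℝ) 1 ×ˢ Set.univ).indicator
        (fun p : ℝ × ℝ => ENNReal.ofReal p.1 * (ENNReal.ofReal ((α + 1) * (1 - p.1 ^ 2) ^ α) *
          F (p.1 * Complex.exp (p.2 * Complex.I)))) p := by
    intro p hp
    have hp1 : 0 < p.1 := hp.1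
    have hz : Complex.polarCoord.symm p = p.1 * Complex.exp (p.2 * Complex.I) := by
      rw [Complex.polarCoord_symm_apply, Complex.exp_mul_I]
      push_cast
      rfl
    have hn : ‖Complex.polarCoord.symm p‖ = p.1 := by
      rw [Complex.norm_polarCoord_symm, abs_of_pos hp1]
    by_cases h1 : p.1 < 1
    · rw [Set.indicator_of_mem (by simpa only [mem_ball_zero_iff, hn] using h1),
        Set.indicator_of_mem (show p ∈ Set.Ioo (0 : ℝ) 1 ×ˢ Set.univ from ⟨⟨hp1, h1⟩, trivial⟩),
        Pi.mul_apply, hn, hz, smul_eq_mul]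
    · rw [Set.indicator_of_notMem (by simpa only [mem_ball_zero_iff, hn] using h1),
        Set.indicator_of_notMem (fun h => h1 h.1.2), smul_zero]
  rw [setLIntegral_congr_fun hms hpt,
    setLIntegral_indicator (measurableSet_Ioo.prod MeasurableSet.univ), htarget,
    Set.prod_inter_prod, Set.univ_inter,
    Set.inter_eq_left.mpr (Set.Ioo_subset_Ioi_self : Set.Ioo (0 : ℝ) 1 ⊆ Set.Ioi 0),
    Measure.volume_eq_prod, ← Measure.prod_restrict, lintegral_prod _ (by fun_prop), smul_eq_mul,
    ← lintegral_const_mul _ (by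
      refine Measurable.lintegral_prod_right' (f := fun p : ℝ × ℝ => ENNReal.ofReal p.1 *
        (ENNReal.ofReal ((α + 1) * (1 - p.1 ^ 2) ^ α) *
          F (p.1 * Complex.exp (p.2 * Complex.I)))) (by fun_prop))]
  refine setLIntegral_congr_fun measurableSet_Ioo fun r hr => ?_
  have hE' : Measurable fun θ : ℝ => F (r * Complex.exp (θ * Complex.I)) := hF.comp (by fun_prop)
  simp only
  rw [lintegral_const_mul _ (by fun_prop), lintegral_const_mul _ hE', ← mul_assoc, ← mul_assoc,
    ← ENNReal.ofReal_mul (by positivity), ← ENNReal.ofReal_mul (mul_nonneg (by positivity) hr.1.le)]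
  congr 2
  ring

theorem lintegral_Ioo_ofReal {f : ℝ → ℝ} (hf : IntervalIntegrable f volume 0 1)
    (h0 : ∀ r ∈ Set.Ioo (0 : ℝ) 1, 0 ≤ f r) :
    ∫⁻ r in Set.Ioo (0 : ℝ) 1, ENNReal.ofReal (f r) = ENNReal.ofReal (∫ r in (0 : ℝ)..1, f r) := by
  rw [intervalIntegral.integral_of_le zero_le_one, integral_Ioc_eq_integral_Ioo,
    ofReal_integral_eq_lintegral_ofReal]
  · exact (intervalIntegrable_iff_integrableOn_Ioo_of_le zero_le_one).mp hf
  · exact (ae_restrict_iff' measurableSet_Ioo).mpr (Filter.Eventually.of_forall h0)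

/-- Integration of a radial function with respect to `μ_α`. -/
theorem lintegral_bergmanMeasure_norm {α : ℝ} (hα : 0 ≤ α) {φ : ℝ → ℝ} (hφ : Measurable φ)
    (hφ0 : ∀ r, 0 ≤ r → 0 ≤ φ r) (hi : IntervalIntegrable
      (fun r => 2 * (α + 1) * r * (1 - r ^ 2) ^ α * φ r) volume 0 1) :
    ∫⁻ z, ENNReal.ofReal (φ ‖z‖) ∂(bergmanMeasure α) =
      ENNReal.ofReal (∫ r in (0 : ℝ)..1, 2 * (α + 1) * r * (1 - r ^ 2) ^ α * φ r) := by
  have hw : ∀ r ∈ Set.Ioo (0 : ℝ) 1, 0 ≤ (1 - r ^ 2) ^ α := fun r hr =>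
    (Real.rpow_pos_of_pos (one_sub_sq_pos hr.1.le hr.2) α).le
  rw [lintegral_bergmanMeasure α (by fun_prop), ← lintegral_Ioo_ofReal hi fun r hr => by
    have := hw r hr; have := hr.1.le; have := hφ0 r hr.1.le; positivity]
  refine setLIntegral_congr_fun measurableSet_Ioo fun r hr => ?_
  have hr0 := hr.1.le
  have := hw r hr
  have := hφ0 r hr0
  have hn : ∀ θ : ℝ, ‖(r : ℂ) * Complex.exp (θ * Complex.I)‖ = r := fun θ => by
    simp [Complex.norm_exp_ofReal_mul_I, abs_of_nonneg hr0]
  simp only [hn, lintegral_const, Measure.restrict_apply_univ, Real.volume_Ioo]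
  rw [← ENNReal.ofReal_mul this, ← ENNReal.ofReal_mul (by positivity)]
  congr 1
  field_simp
  ring

theorem isProbabilityMeasure_bergmanMeasure {α : ℝ} (hα : 0 ≤ α) :
    IsProbabilityMeasure (bergmanMeasure α) := by
  constructor
  have h := lintegral_bergmanMeasure_norm hα (φ := fun _ => 1) measurable_const
    (fun _ _ => zero_le_one) (by
      simpa using (continuous_radialWeight hα).intervalIntegrable 0 1)
  simpa [integral_radialWeight hα] using h

theorem ae_norm_lt_one_bergmanMeasure (α : ℝ) : ∀ᵐ z ∂(bergmanMeasure α), ‖z‖ < 1 := by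
  refine (withDensity_absolutelyContinuous _ _).ae_le ?_
  refine Measure.ae_smul_measure ?_ _
  filter_upwards [ae_restrict_mem measurableSet_ball] with z hz
  simpa using hz

theorem lintegral_artanh_norm_rpow {α p : ℝ} (hα : 0 ≤ α) (hp : 0 < p) :
    ∫⁻ z, ENNReal.ofReal (Real.artanh ‖z‖ ^ p) ∂(bergmanMeasure α) =
      ENNReal.ofReal (artanhMoment α p) :=
  lintegral_bergmanMeasure_norm hα (φ := fun r => Real.artanh r ^ p)
    (by unfold Real.artanh; fun_prop)
    (fun r hr => Real.rpow_nonneg (Real.artanh_nonneg hr) p) (intervalIntegrable_artanhMoment hα hp)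

theorem aestronglyMeasurable_bergmanMeasure (α : ℝ) {f : ℂ → ℂ}
    (hf : ContinuousOn f (Metric.ball 0 1)) : AEStronglyMeasurable f (bergmanMeasure α) := by
  have h := hf.aestronglyMeasurable (μ := volume) measurableSet_ball
  exact (h.smul_measure _).mono_ac (withDensity_absolutelyContinuous _ _)

/-- The `L²` norm of a Bloch function with respect to `μ_α`, computed by Parseval's identity on
circles and compared with the unweighted case. -/
theorem IsBlochUnit.lintegral_sq_le {α : ℝ} (hα : 0 ≤ α) {g : ℂ → ℂ} (hg : IsBlochUnit g) :
    ∫⁻ z, ENNReal.ofReal (‖g z‖ ^ 2) ∂(bergmanMeasure α) ≤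
      ENNReal.ofReal (1 - 1 / 320000000) := by
  -- only the values of `g` in the disk matter; cutting `g` off makes it measurable
  set G : ℂ → ℂ := (Metric.ball (0 : ℂ) 1).indicator g with hG
  have hGm : Measurable G := by
    classical
    have := hg.differentiableOn.continuousOn.measurable_piecewise
      (continuousOn_const (c := (0 : ℂ)) (s := (Metric.ball (0 : ℂ) 1)ᶜ)) measurableSet_ball
    rwa [hG, ← Set.piecewise_eq_indicator]
  have hGg : ∀ z : ℂ, ‖z‖ < 1 → G z = g z := fun z hz =>
    Set.indicator_of_mem (by simpa using hz) g
  have hae : ∫⁻ z, ENNReal.ofReal (‖g z‖ ^ 2) ∂(bergmanMeasure α) =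
      ∫⁻ z, ENNReal.ofReal (‖G z‖ ^ 2) ∂(bergmanMeasure α) := by
    refine lintegral_congr_ae ?_
    filter_upwards [ae_norm_lt_one_bergmanMeasure α] with z hz
    rw [hGg z hz]
  have hw : ∀ r ∈ Set.Ioo (0 : ℝ) 1, 0 ≤ (1 - r ^ 2) ^ α := fun r hr =>
    (Real.rpow_pos_of_pos (one_sub_sq_pos hr.1.le hr.2) α).le
  rw [hae, lintegral_bergmanMeasure α (by fun_prop)]
  have hcirc : ∀ r ∈ Set.Ioo (0 : ℝ) 1,
      ENNReal.ofReal ((α + 1) / Real.pi * r * (1 - r ^ 2) ^ α) *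
        ∫⁻ θ in Set.Ioo (-Real.pi) Real.pi,
          ENNReal.ofReal (‖G (r * Complex.exp (θ * Complex.I))‖ ^ 2) =
      ∑' n, ENNReal.ofReal (‖taylorCoeff g n‖ ^ 2 *
        (2 * (α + 1) * r * (1 - r ^ 2) ^ α * (r ^ 2) ^ n)) := by
    intro r hr
    have hn : ∀ θ : ℝ, ‖(r : ℂ) * Complex.exp (θ * Complex.I)‖ = r := fun θ => by
      simp [Complex.norm_exp_ofReal_mul_I, abs_of_nonneg hr.1.le]
    have hcont : Continuous fun θ : ℝ => g (r * Complex.exp (θ * Complex.I)) :=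
      hg.differentiableOn.continuousOn.comp_continuous (by fun_prop) fun θ => by
        rw [mem_ball_zero_iff, hn]; exact hr.2
    have hpi : -Real.pi ≤ Real.pi := by linarith [Real.pi_pos]
    have hint : ∫⁻ θ in Set.Ioo (-Real.pi) Real.pi,
        ENNReal.ofReal (‖G (r * Complex.exp (θ * Complex.I))‖ ^ 2) =
        ENNReal.ofReal (∫ θ in (-Real.pi)..Real.pi, ‖g (r * Complex.exp (θ * Complex.I))‖ ^ 2) := by
      rw [intervalIntegral.integral_of_le hpi, integral_Ioc_eq_integral_Ioo,
        ofReal_integral_eq_lintegral_ofReal]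
      · refine lintegral_congr fun θ => ?_
        rw [hGg _ (by rw [hn]; exact hr.2)]
      · exact ((hcont.norm.pow 2).integrableOn_Icc).mono_set Set.Ioo_subset_Icc_self
      · exact Filter.Eventually.of_forall fun θ => by positivity
    have hP := hasSum_sq_norm_taylorCoeff hg.differentiableOn hr.1.le hr.2
    have hr0 := hr.1.le
    have := hw r hr
    rw [hint, ← hP.tsum_eq, ENNReal.ofReal_tsum_of_nonneg (fun n => by positivity) hP.summable,
      ← ENNReal.tsum_mul_left]
    refine tsum_congr fun n => ?_
    rw [← ENNReal.ofReal_mul (by positivity)]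
    congr 1
    field_simp
  rw [setLIntegral_congr_fun measurableSet_Ioo hcirc,
    lintegral_tsum fun n => by fun_prop]
  refine ENNReal.tsum_le_of_sum_range_le fun N => ?_
  have hterm : ∀ n, ∫⁻ r in Set.Ioo (0 : ℝ) 1, ENNReal.ofReal (‖taylorCoeff g n‖ ^ 2 *
      (2 * (α + 1) * r * (1 - r ^ 2) ^ α * (r ^ 2) ^ n)) ≤
      ENNReal.ofReal (‖taylorCoeff g n‖ ^ 2 / (n + 1)) := fun n => by
    have hc : Continuous fun r : ℝ => ‖taylorCoeff g n‖ ^ 2 *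
        (2 * (α + 1) * r * (1 - r ^ 2) ^ α * (r ^ 2) ^ n) :=
      continuous_const.mul ((continuous_radialWeight hα).mul (by fun_prop))
    rw [lintegral_Ioo_ofReal (hc.intervalIntegrable _ _) fun r hr => by
      have := hw r hr; have := hr.1.le; positivity]
    refine ENNReal.ofReal_le_ofReal ?_
    rw [intervalIntegral.integral_const_mul, div_eq_mul_one_div]
    exact mul_le_mul_of_nonneg_left (integral_radialWeight_mul_pow_le hα n) (by positivity)
  refine (Finset.sum_le_sum fun n _ => hterm n).trans ?_
  rw [← ENNReal.ofReal_sum_of_nonneg fun n _ => by positivity]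
  exact ENNReal.ofReal_le_ofReal (hg.sum_sq_taylorCoeff_div_le N)

/-! ### Contractivity -/

/-- A uniform bound `κ < 1` on the `q`-th moment leaves room for a larger exponent, because
`x ^ (q + ε) ≤ (1 - ε) * x ^ q + ε * x ^ (q + 1)` and the moments of order `q + 1` are uniformly
bounded by that of `artanh |z|`. -/
theorem exists_gt_forall_lintegral_rpow_le_one {α q κ : ℝ} (hα : 0 ≤ α) (hq : 0 < q)
    (hκ0 : 0 ≤ κ) (hκ1 : κ < 1) (h : ∀ g, IsBlochUnit g →
      ∫⁻ z, ENNReal.ofReal (‖g z‖ ^ q) ∂(bergmanMeasure α) ≤ ENNReal.ofReal κ) :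
    ∃ P, q < P ∧ ∀ g, IsBlochUnit g →
      ∫⁻ z, ENNReal.ofReal (‖g z‖ ^ P) ∂(bergmanMeasure α) ≤ 1 := by
  set J := artanhMoment α (q + 1) with hJ
  have hJ0 : 0 ≤ J := artanhMoment_nonneg hα
  set ε : ℝ := (1 - κ) / (J + 1) with hε
  have hε0 : 0 < ε := div_pos (by linarith) (by linarith)
  have hεJ : ε * (J + 1) = 1 - κ := div_mul_cancel₀ _ (by linarith)
  have hε1 : ε ≤ 1 := by nlinarith
  refine ⟨q + ε, by linarith, fun g hg => ?_⟩
  have hpt : ∀ᵐ z ∂(bergmanMeasure α), ENNReal.ofReal (‖g z‖ ^ (q + ε)) ≤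
      ENNReal.ofReal (1 - ε) * ENNReal.ofReal (‖g z‖ ^ q) +
        ENNReal.ofReal ε * ENNReal.ofReal (Real.artanh ‖z‖ ^ (q + 1)) := by
    filter_upwards [ae_norm_lt_one_bergmanMeasure α] with z hz
    have hx := norm_nonneg (g z)
    have hA := Real.artanh_nonneg (norm_nonneg z)
    rw [← ENNReal.ofReal_mul (by linarith), ← ENNReal.ofReal_mul hε0.le,
      ← ENNReal.ofReal_add (mul_nonneg (by linarith) (by positivity)) (by positivity)]
    refine ENNReal.ofReal_le_ofReal ?_
    have h1 := Real.geom_mean_le_arith_mean2_weighted (w₁ := 1 - ε) (w₂ := ε)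
      (p₁ := ‖g z‖ ^ q) (p₂ := ‖g z‖ ^ (q + 1)) (by linarith) hε0.le (by positivity)
      (by positivity) (by ring)
    rw [← Real.rpow_mul hx, ← Real.rpow_mul hx,
      ← Real.rpow_add_of_nonneg hx (mul_nonneg hq.le (by linarith)) (by positivity),
      show q * (1 - ε) + (q + 1) * ε = q + ε by ring] at h1
    have h2 := Real.rpow_le_rpow hx (hg.norm_le_artanh hz) (show 0 ≤ q + 1 by linarith)
    exact h1.trans (by gcongr)
  calc ∫⁻ z, ENNReal.ofReal (‖g z‖ ^ (q + ε)) ∂(bergmanMeasure α)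
      ≤ _ := lintegral_mono_ae hpt
    _ = ENNReal.ofReal (1 - ε) * ∫⁻ z, ENNReal.ofReal (‖g z‖ ^ q) ∂(bergmanMeasure α) +
        ENNReal.ofReal ε * ENNReal.ofReal J := by
      rw [lintegral_add_right _ (by unfold Real.artanh; fun_prop),
        lintegral_const_mul' _ _ ENNReal.ofReal_ne_top,
        lintegral_const_mul' _ _ ENNReal.ofReal_ne_top,
        lintegral_artanh_norm_rpow hα (by linarith)]
    _ ≤ ENNReal.ofReal (1 - ε) * ENNReal.ofReal κ + ENNReal.ofReal ε * ENNReal.ofReal J := by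
      gcongr
      exact h g hg
    _ ≤ 1 := by
      rw [← ENNReal.ofReal_mul (by linarith), ← ENNReal.ofReal_mul hε0.le,
        ← ENNReal.ofReal_add (mul_nonneg (by linarith) hκ0) (by positivity),
        ENNReal.ofReal_le_one]
      nlinarith

/-- The exponent: for `B(1/2, α + 1) ≥ 1` it comes from the `L²` bound, otherwise from the
moment of `artanh |z|` of order `2 / B(1/2, α + 1)`. -/
theorem exists_exponent {α : ℝ} (hα : 0 ≤ α) :
    ∃ P, 2 * max 1 (1 / eulerBeta (1 / 2) (α + 1)) < P ∧ ∀ g, IsBlochUnit g →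
      ∫⁻ z, ENNReal.ofReal (‖g z‖ ^ P) ∂(bergmanMeasure α) ≤ 1 := by
  set β := ∫ r in (0 : ℝ)..1, (1 - r ^ 2) ^ α with hβ
  have hB : eulerBeta (1 / 2) (α + 1) = 2 * β := eulerBeta_half hα
  have hβ0 : 0 < β := by
    by_contra hneg
    have := lt_integral_one_sub_sq_rpow hα
    rw [← hβ] at this
    nlinarith
  rw [hB]
  rcases le_or_gt 1 (2 * β) with h | h
  · rw [max_eq_left ((div_le_one (by positivity)).mpr h)]
    refine exists_gt_forall_lintegral_rpow_le_one hα (κ := 1 - 1 / 320000000) (by norm_num)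
      (by norm_num) (by norm_num) fun g hg => ?_
    have := hg.lintegral_sq_le hα
    norm_num at this ⊢
    exact this
  · have h1 : 1 ≤ 1 / (2 * β) := (one_le_div (by positivity)).mpr h.le
    have h1' : 1 < 1 / (2 * β) := (one_lt_div (by positivity)).mpr h
    rw [max_eq_right h1]
    have hq : 2 * (1 / (2 * β)) * β = 1 := by field_simp
    refine exists_gt_forall_lintegral_rpow_le_one hα (by positivity) (artanhMoment_nonneg hα)
      (artanhMoment_lt_one hα (by linarith) hq) fun g hg => ?_
    rw [← lintegral_artanh_norm_rpow hα (by positivity)]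
    refine lintegral_mono_ae ?_
    filter_upwards [ae_norm_lt_one_bergmanMeasure α] with z hz
    exact ENNReal.ofReal_le_ofReal
      (Real.rpow_le_rpow (norm_nonneg _) (hg.norm_le_artanh hz) (by positivity))

theorem eLpNorm_le_one_of_lintegral_rpow_le {α P : ℝ} (hP : 0 < P) {g : ℂ → ℂ}
    (h : ∫⁻ z, ENNReal.ofReal (‖g z‖ ^ P) ∂(bergmanMeasure α) ≤ 1) :
    eLpNorm g (ENNReal.ofReal P) (bergmanMeasure α) ≤ 1 := by
  rw [eLpNorm_eq_lintegral_rpow_enorm_toReal (by simpa using hP) ENNReal.ofReal_ne_top,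
    ENNReal.toReal_ofReal hP.le]
  refine ENNReal.rpow_le_one ?_ (by positivity)
  refine le_trans (le_of_eq (lintegral_congr fun z => ?_)) h
  rw [← ofReal_norm, ENNReal.ofReal_rpow_of_nonneg (norm_nonneg _) hP.le]

/-- Rescaling: `(f - f 0) / c` is a Bloch function of seminorm at most `1` when
`c > 0` and `c ≥ blochSeminorm f`. -/
theorem MemBloch.isBlochUnit_div {f : ℂ → ℂ} (hf : MemBloch f) {c : ℝ} (hc0 : 0 < c)
    (hc : blochSeminorm f ≤ c) : IsBlochUnit fun z => (f z - f 0) / c := by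
  refine ⟨(hf.1.sub_const (f 0)).div_const _, by simp, fun z hz => ?_⟩
  have h := (le_csSup hf.2 (Set.mem_image_of_mem _ (by simpa using hz))).trans hc
  rw [deriv_div_const, deriv_sub_const, norm_div, Complex.norm_real, Real.norm_of_nonneg hc0.le,
    div_mul_eq_mul_div, div_le_one hc0]
  exact h

theorem blochSeminorm_nonneg (f : ℂ → ℂ) : 0 ≤ blochSeminorm f := by
  refine Real.sSup_nonneg ?_
  rintro _ ⟨z, hz, rfl⟩
  have : ‖z‖ < 1 := by simpa using hz
  exact mul_nonneg (norm_nonneg _) (one_sub_sq_pos (norm_nonneg z) this).le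

/-- The contractive bound up to `c > blochSeminorm f`, by Minkowski's inequality at the exponent `P`
and monotonicity of `L^p` norms of a probability measure. -/
theorem MemBloch.eLpNorm_le {α P p : ℝ} (hα : 0 ≤ α) (hP : 1 ≤ P) (hpP : p ≤ P)
    (h : ∀ g, IsBlochUnit g → ∫⁻ z, ENNReal.ofReal (‖g z‖ ^ P) ∂(bergmanMeasure α) ≤ 1)
    {f : ℂ → ℂ} (hf : MemBloch f) {c : ℝ} (hc : blochSeminorm f < c) :
    eLpNorm f (ENNReal.ofReal p) (bergmanMeasure α) ≤ ENNReal.ofReal (‖f 0‖ + c) := by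
  have := isProbabilityMeasure_bergmanMeasure hα
  have hc0 : 0 < c := (blochSeminorm_nonneg f).trans_lt hc
  have hcC : (c : ℂ) ≠ 0 := by exact_mod_cast hc0.ne'
  have hfm := aestronglyMeasurable_bergmanMeasure α hf.1.continuousOn
  set g : ℂ → ℂ := fun z => (f z - f 0) / c with hg
  have hgu : IsBlochUnit g := hf.isBlochUnit_div hc0 hc.le
  have hgm := aestronglyMeasurable_bergmanMeasure α hgu.differentiableOn.continuousOn
  have hfg : f = (fun _ => f 0) + (c : ℂ) • g := by
    ext z
    simp only [hg, Pi.add_apply, Pi.smul_apply, smul_eq_mul]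
    field_simp
    ring
  have hP0 : ENNReal.ofReal P ≠ 0 := by simp; linarith
  calc eLpNorm f (ENNReal.ofReal p) (bergmanMeasure α)
      ≤ eLpNorm f (ENNReal.ofReal P) (bergmanMeasure α) :=
        eLpNorm_le_eLpNorm_of_exponent_le (ENNReal.ofReal_le_ofReal hpP) hfm
    _ ≤ eLpNorm (fun _ => f 0) (ENNReal.ofReal P) (bergmanMeasure α) +
        eLpNorm ((c : ℂ) • g) (ENNReal.ofReal P) (bergmanMeasure α) := by
      conv_lhs => rw [hfg]
      exact eLpNorm_add_le aestronglyMeasurable_const (hgm.const_smul _)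
        (by rw [← ENNReal.ofReal_one]; exact ENNReal.ofReal_le_ofReal hP)
    _ ≤ ‖f 0‖ₑ + ‖(c : ℂ)‖ₑ * 1 := by
      rw [eLpNorm_const _ hP0 (NeZero.ne _), measure_univ, ENNReal.one_rpow, mul_one,
        eLpNorm_const_smul]
      gcongr
      exact eLpNorm_le_one_of_lintegral_rpow_le (by linarith) (h g hgu)
    _ = ENNReal.ofReal (‖f 0‖ + c) := by
      rw [mul_one, ← ofReal_norm, ← ofReal_norm, Complex.norm_real, Real.norm_of_nonneg hc0.le,
        ENNReal.ofReal_add (norm_nonneg _) hc0.le]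

theorem mainTheorem6 (α : ℝ) (hα : 0 ≤ α) :
    ∃ pα : ℝ, 2 * max 1 (1 / eulerBeta (1 / 2) (α + 1)) < pα ∧
      ∀ p : ℝ, 0 < p → p ≤ pα → ∀ f : ℂ → ℂ, MemBloch f →
        MemBergman p α f ∧ bergmanNorm p α f ≤ blochNorm f := by
  obtain ⟨P, hP, h⟩ := exists_exponent hα
  have hP1 : 1 ≤ P := by linarith [le_max_left 1 (1 / eulerBeta (1 / 2) (α + 1))]
  refine ⟨P, hP, fun p hp hpP f hf => ?_⟩
  have hfm := aestronglyMeasurable_bergmanMeasure α hf.1.continuousOn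
  have hp0 : ENNReal.ofReal p ≠ 0 := by simpa using hp
  have hmem : MemLp f (ENNReal.ofReal p) (bergmanMeasure α) :=
    ⟨hfm, (hf.eLpNorm_le hα hP1 hpP h (lt_add_one _)).trans_lt ENNReal.ofReal_lt_top⟩
  refine ⟨⟨hf.1, ?_⟩, ?_⟩
  · simpa [ENNReal.toReal_ofReal hp.le] using hmem.integrable_norm_rpow hp0 ENNReal.ofReal_ne_top
  · refine le_of_forall_pos_le_add fun δ hδ => ?_
    have hδ' := hf.eLpNorm_le hα hP1 hpP h (lt_add_of_pos_right (blochSeminorm f) hδ)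
    rw [hmem.eLpNorm_eq_integral_rpow_norm hp0 ENNReal.ofReal_ne_top,
      ENNReal.toReal_ofReal hp.le, ENNReal.ofReal_le_ofReal_iff
        (add_nonneg (norm_nonneg _) (by linarith [blochSeminorm_nonneg f]))] at hδ'
    rw [bergmanNorm, blochNorm, one_div, add_assoc]
    exact hδ'
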